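/- Let $n\in\mathbb{N}$, let $f=(f_1,\dots,f_n)$ be a tuple of polynomials in $\mathbb{R}[x_1,\dots,x_n]$, and let $\varphi(\cdot,x)$ be the solution of the initial value problem $x'=f(x)$ with initial value $x\in\mathbb{R}^n$, on its maximal interval of existence $I_x$. For $S\subseteq\mathbb{R}^n$ the exit set is $$\mathrm{Exit}_f(S)=\{x\in S \mid \forall t\in I_x\cap(0,\infty)\ \exists s\in(0,t):\ \varphi(s,x)\notin S\}.$$ Formulas are built from the atoms $\mathbf T$, $\mathbf F$, $p<0$ and $p=0$ ($p\in\mathbb{R}[x_1,\dots,x_n]$) by $\land,\lor,\lnot$; a formula is identified with the semi-algebraic subset of $\mathbb{R}^n$ it describes; $p\ne0$ abbreviates $(-p<0)\lor(p<0)$. For a polynomial $p$ let $p'=\nabla p\cdot f$ be its Lie derivative, $p^{(k)}$ the $k$-th iterated Lie derivative, and $\mathrm{ord}_f(p)$ the least $k$ with $\langle p,\dots,p^{(k)}\rangle=\langle p,\dots,p^{(K)}\rangle$ for all $K\ge k$. Fix a monomial order. Put $\mathrm{rem}_0=p$ and let $\mathrm{rem}_{i+1}$ be the remainder that the multivariate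 division algorithm returns for $\mathrm{rem}_i'$ and the ordered list of divisors $\mathrm{rem}_0,\dots,\mathrm{rem}_i$ (the leading term is cancelled against the first nonzero divisor whose leading monomial divides it, and is moved to the remainder if there is none). With $N=\mathrm{ord}_f(p)$, define formulas by $$\mathrm{In}_f(p=0):=\bigwedge_{i=0}^{N}\mathrm{rem}_i=0,\qquad \mathrm{In}_f(p<0):=\bigvee_{i=0}^{N}\Bigl(\bigwedge_{j<i}\mathrm{rem}_j=0\ \land\ \mathrm{rem}_i<0\Bigr),$$ $\mathrm{In}_f(\mathbf T):=\mathbf T$, $\mathrm{In}_f(\mathbf F):=\mathbf F$, and let $\mathrm{In}_f$ commute with $\land,\lor,\lnot$. For atoms $A$ define the formula $\mathrm{E}_f(A)$ by $\mathrm{E}_f(\mathbf T)=\mathrm{E}_f(\mathbf F)=\mathrm{E}_f(p<0):=\mathbf F$ and $$\mathrm{E}_f(p=0):=\bigvee_{i=1}^{N}\Bigl(\bigwedge_{j<i}\mathrm{rem}_j=0\ \land\ \mathrm{rem}_i\neq0\Bigr).$$ Let $\mathrm{Neg}(\mathbf F):=\mathbf T$, $\mathrm{Neg}(\mathbf T):=\mathbf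 F$, $\mathrm{Neg}(p<0):=(-p<0)\lor(-p=0)$, $\mathrm{Neg}(p=0):=(-p<0)\lor(p<0)$, $\mathrm{Neg}(S_1\land S_2):=\lnot S_1\lor\lnot S_2$, $\mathrm{Neg}(S_1\lor S_2):=\lnot S_1\land\lnot S_2$, $\mathrm{Neg}(\lnot S):=S$. Let $\mathrm{Reduce}$ return the truth value of an existential sentence of real arithmetic. The recursive procedure $\mathrm{NonEmpty}_f$ is defined by $$\begin{aligned} \mathrm{NonEmpty}_f(A,R)&:=\mathrm{Reduce}\bigl(\exists x_1\cdots\exists x_n.\ \mathrm{E}_f(A)\land R\bigr)\quad(A\text{ an atom}),\\ \mathrm{NonEmpty}_f(S_1\land S_2,R)&:=\mathrm{NonEmpty}_f(S_1,S_2\land R)\lor\mathrm{NonEmpty}_f(S_2,S_1\land R),\\ \mathrm{NonEmpty}_f(S_1\lor S_2,R)&:=\mathrm{NonEmpty}_f(S_1,\lnot\mathrm{In}_f(S_2)\land R)\lor\mathrm{NonEmpty}_f(S_2,\lnot\mathrm{In}_f(S_1)\land R),\\ \mathrm{NonEmpty}_f(\lnot S,R)&:=\mathrm{NonEmpty}_f(\mathrm{Neg}(S),R).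 \end{aligned}$$ Then for all formulas $S$ and $R$, $\mathrm{NonEmpty}_f(S,R)$ returns False if and only if $\mathrm{Exit}_f(S)\cap R=\emptyset$. -/

import Mathlib

universe u

namespace ExitSet

/-- Real polynomials in `n` variables. -/
abbrev Poly (n : ℕ) : Type := MvPolynomial (Fin n) ℝ

section Flow

/-- The vector field on `ℝⁿ` given by a tuple `f` of polynomials. -/
noncomputable def vectorField {n : ℕ} (f : Fin n → Poly n) (x : Fin n → ℝ) : Fin n → ℝ :=
  fun i => MvPolynomial.eval x (f i)

/-- `γ` solves `x' = f(x)`, `γ(0) = x₀` on the open interval `(a, b)`, which contains `0`. -/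
def IsSolution {n : ℕ} (f : Fin n → Poly n) (x₀ : Fin n → ℝ) (a b : ℝ)
    (γ : ℝ → Fin n → ℝ) : Prop :=
  a < 0 ∧ 0 < b ∧ γ 0 = x₀ ∧ IsIntegralCurveOn γ (fun _ => vectorField f) (Set.Ioo a b)

/-- The maximal interval of existence `I_{x₀}`: the times reached by some solution. -/
def maxInterval {n : ℕ} (f : Fin n → Poly n) (x₀ : Fin n → ℝ) : Set ℝ :=
  {t | ∃ (a b : ℝ) (γ : ℝ → Fin n → ℝ), IsSolution f x₀ a b γ ∧ t ∈ Set.Ioo a b}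

open Classical in
/-- The local flow `φ(t, x₀)`. For `t ∈ I_{x₀}` it is the value at `t` of a solution through `x₀`
(any two solutions agree, as polynomial vector fields are locally Lipschitz). Outside `I_{x₀}` the
flow is undefined and the value is immaterial. -/
noncomputable def flow {n : ℕ} (f : Fin n → Poly n) (t : ℝ) (x₀ : Fin n → ℝ) : Fin n → ℝ :=
  if h : t ∈ maxInterval f x₀ then h.choose_spec.choose_spec.choose t else x₀

/-- The exit set of `S` under the local flow of `x' = f(x)`. -/
def exitSet {n : ℕ} (f : Fin n → Poly n) (S : Set (Fin n → ℝ)) : Set (Fin n → ℝ) :=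
  {x | x ∈ S ∧ ∀ t ∈ maxInterval f x, 0 < t → ∃ s ∈ Set.Ioo 0 t, flow f s x ∉ S}

end Flow

/-- Quantifier-free formulas of real arithmetic, with atoms `T`, `F`, `p < 0` and `p = 0`. -/
inductive Formula (n : ℕ) : Type
  | tru : Formula n
  | fls : Formula n
  | lt : Poly n → Formula n
  | eq : Poly n → Formula n
  | and : Formula n → Formula n → Formula n
  | or : Formula n → Formula n → Formula n
  | not : Formula n → Formula n

namespace Formula

/-- The semi-algebraic set described by a formula. -/
def toSet {n : ℕ} : Formula n → Set (Fin n → ℝ)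
  | tru => Set.univ
  | fls => ∅
  | lt p => {x | MvPolynomial.eval x p < 0}
  | eq p => {x | MvPolynomial.eval x p = 0}
  | and S₁ S₂ => toSet S₁ ∩ toSet S₂
  | or S₁ S₂ => toSet S₁ ∪ toSet S₂
  | not S => (toSet S)ᶜ

/-- `p ≠ 0`, as syntactic sugar for `-p < 0 ∨ p < 0`. -/
noncomputable def ne {n : ℕ} (p : Poly n) : Formula n := or (lt (-p)) (lt p)

/-- Finite conjunctions (the empty one is `T`). -/
def conj {n : ℕ} (l : List (Formula n)) : Formula n := l.foldr and tru

/-- Finite disjunctions (the empty one is `F`). -/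
def disj {n : ℕ} (l : List (Formula n)) : Formula n := l.foldr or fls

/-- The procedure `Neg`: one step of pushing a negation inwards. -/
noncomputable def neg {n : ℕ} : Formula n → Formula n
  | tru => fls
  | fls => tru
  | lt p => or (lt (-p)) (eq (-p))
  | eq p => or (lt (-p)) (lt p)
  | and S₁ S₂ => or (not S₁) (not S₂)
  | or S₁ S₂ => and (not S₁) (not S₂)
  | not S => S

/-- A measure on formulas, used only for the termination of `nonEmpty`. -/
def weight {n : ℕ} : Formula n → ℕ
  | tru => 2
  | fls => 2
  | lt _ => 2
  | eq _ => 2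
  | and S₁ S₂ => weight S₁ + weight S₂ + 1
  | or S₁ S₂ => weight S₁ + weight S₂ + 1
  | not S => 3 * weight S

theorem weight_pos {n : ℕ} (S : Formula n) : 0 < S.weight := by
  induction S <;> simp only [weight] <;> omega

theorem weight_neg_lt {n : ℕ} (S : Formula n) : S.neg.weight < S.not.weight := by
  cases S with
  | not S => have := weight_pos S; simp only [neg, weight]; omega
  | _ => simp only [neg, weight]; omega

end Formula

section Division

open Classical in
/-- The degree with respect to a monomial order, with `⊥` for the zero polynomial. -/
noncomputable def synDegree {n : ℕ} (m : MonomialOrder.{0, u} (Fin n)) (p : Poly n) :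
    WithBot m.syn :=
  if p = 0 then ⊥ else ((m.toSyn (m.degree p) : m.syn) : WithBot m.syn)

theorem synDegree_lt {n : ℕ} (m : MonomialOrder.{0, u} (Fin n)) {p q : Poly n} (hp : p ≠ 0)
    (hle : m.toSyn (m.degree q) ≤ m.toSyn (m.degree p))
    (hc : MvPolynomial.coeff (m.degree p) q = 0) : synDegree m q < synDegree m p := by
  unfold synDegree
  rw [if_neg hp]
  split_ifs with hq
  · exact WithBot.bot_lt_coe _
  · refine WithBot.coe_lt_coe.2 (lt_of_le_of_ne hle fun h => ?_)
    rw [← m.toSyn.injective h] at hc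
    exact hq (m.leadingCoeff_eq_zero_iff.1 hc)

/-- Cancel the leading term of `p` against that of `g`: `p - (LT(p) / LT(g)) g`. -/
noncomputable def cancelLT {n : ℕ} (m : MonomialOrder.{0, u} (Fin n)) (p g : Poly n) :
    Poly n :=
  p - MvPolynomial.monomial (m.degree p - m.degree g) (m.leadingCoeff p / m.leadingCoeff g) * g

theorem synDegree_cancelLT_lt {n : ℕ} (m : MonomialOrder.{0, u} (Fin n)) {p g : Poly n}
    (hp : p ≠ 0) (hg : g ≠ 0) (hd : m.degree g ≤ m.degree p) :
    synDegree m (cancelLT m p g) < synDegree m p := by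
  classical
  have hg' : m.leadingCoeff g ≠ 0 := m.leadingCoeff_ne_zero_iff.2 hg
  have hp' : m.leadingCoeff p ≠ 0 := m.leadingCoeff_ne_zero_iff.2 hp
  have hadd : m.degree p - m.degree g + m.degree g = m.degree p := tsub_add_cancel_of_le hd
  have hmon : m.degree (MvPolynomial.monomial (m.degree p - m.degree g)
      (m.leadingCoeff p / m.leadingCoeff g)) = m.degree p - m.degree g := by
    rw [m.degree_monomial, if_neg (div_ne_zero hp' hg')]
  refine synDegree_lt m hp ?_ ?_
  · refine le_trans m.degree_sub_le (sup_le le_rfl ?_)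
    refine le_trans m.degree_mul_le ?_
    rw [hmon, hadd]
  · unfold cancelLT
    have h := MvPolynomial.coeff_monomial_mul (m.degree g) (m.degree p - m.degree g)
      (m.leadingCoeff p / m.leadingCoeff g) g
    rw [hadd] at h
    rw [MvPolynomial.coeff_sub, h]
    change m.leadingCoeff p - m.leadingCoeff p / m.leadingCoeff g * m.leadingCoeff g = 0
    rw [div_mul_cancel₀ _ hg', sub_self]

theorem synDegree_sub_leadingTerm_lt {n : ℕ} (m : MonomialOrder.{0, u} (Fin n)) {p : Poly n}
    (hp : p ≠ 0) : synDegree m (p - m.leadingTerm p) < synDegree m p := by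
  classical
  refine synDegree_lt m hp ?_ ?_
  · refine le_trans m.degree_sub_le (sup_le le_rfl ?_)
    rw [m.degree_leadingTerm]
  · simp [MonomialOrder.leadingTerm, MvPolynomial.coeff_monomial, MonomialOrder.leadingCoeff]

open Classical in
/-- The remainder of `p` on division by the list `F`, computed by the multivariate division
algorithm for the monomial order `m`: while `p ≠ 0`, cancel the leading term of `p` against the
first nonzero element of `F` whose leading monomial divides that of `p`; if there is none, move the
leading term of `p` to the remainder. -/
noncomputable def remainder {n : ℕ} (m : MonomialOrder.{0, u} (Fin n)) (F : List (Poly n))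
    (p : Poly n) : Poly n :=
  if _hp : p = 0 then 0
  else
    match _hF : F.find? (fun g => decide (g ≠ 0 ∧ m.degree g ≤ m.degree p)) with
    | some g => remainder m F (cancelLT m p g)
    | none => m.leadingTerm p + remainder m F (p - m.leadingTerm p)
termination_by (wellFounded_lt (α := WithBot m.syn)).wrap (synDegree m p)
decreasing_by
  · have h := List.find?_some _hF
    rw [decide_eq_true_eq] at h
    exact synDegree_cancelLT_lt m _hp h.1 h.2
  · exact synDegree_sub_leadingTerm_lt m _hp

end Division

section Lie

/-- The Lie derivative `p' = ∇p ⬝ f` of a polynomial. -/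
noncomputable def lie {n : ℕ} (f : Fin n → Poly n) (p : Poly n) : Poly n :=
  ∑ i, MvPolynomial.pderiv i p * f i

/-- The ideal `⟨p, p', …, p^(k)⟩`. -/
noncomputable def lieIdeal {n : ℕ} (f : Fin n → Poly n) (p : Poly n) (k : ℕ) : Ideal (Poly n) :=
  Ideal.span ((fun i => (lie f)^[i] p) '' Set.Iic k)

/-- The order of `p`: the least `k` at which the chain `⟨p⟩ ⊆ ⟨p, p'⟩ ⊆ ⋯` has stabilised. -/
noncomputable def ord {n : ℕ} (f : Fin n → Poly n) (p : Poly n) : ℕ :=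
  sInf {k | ∀ K, k ≤ K → lieIdeal f p k = lieIdeal f p K}

/-- The remainders of Lie derivatives: `rem₀ = p`, and `rem_{i+1}` is the remainder of `rem_i'` on
division by `rem₀, …, rem_i`. -/
noncomputable def lieRem {n : ℕ} (m : MonomialOrder.{0, u} (Fin n)) (f : Fin n → Poly n)
    (p : Poly n) : ℕ → Poly n
  | 0 => p
  | i + 1 =>
    remainder m (List.ofFn fun j : Fin (i + 1) => lieRem m f p j.1) (lie f (lieRem m f p i))
termination_by i => i
decreasing_by
  · exact j.2
  · exact Nat.lt_succ_self i

end Lie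

section Procedures

open Formula

/-- `rem₀ = 0 ∧ … ∧ rem_{k-1} = 0`. -/
noncomputable def remsZero {n : ℕ} (m : MonomialOrder.{0, u} (Fin n)) (f : Fin n → Poly n)
    (p : Poly n) (k : ℕ) : Formula n :=
  conj ((List.range k).map fun j => Formula.eq (lieRem m f p j))

/-- The procedure `In_f`: every atom of the formula is replaced by its `In_f`. -/
noncomputable def inProc {n : ℕ} (m : MonomialOrder.{0, u} (Fin n)) (f : Fin n → Poly n) :
    Formula n → Formula n
  | .tru => .tru
  | .fls => .fls
  | .eq p => remsZero m f p (ord f p + 1)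
  | .lt p => disj ((List.range (ord f p + 1)).map fun i =>
      .and (remsZero m f p i) (.lt (lieRem m f p i)))
  | .and S₁ S₂ => .and (inProc m f S₁) (inProc m f S₂)
  | .or S₁ S₂ => .or (inProc m f S₁) (inProc m f S₂)
  | .not S => .not (inProc m f S)

/-- The formula that the procedure `Exit_f` returns for the atom `p = 0`: the disjunction over
`1 ≤ i ≤ ord_f(p)` of `rem₀ = 0 ∧ … ∧ rem_{i-1} = 0 ∧ rem_i ≠ 0`. -/
noncomputable def exitEq {n : ℕ} (m : MonomialOrder.{0, u} (Fin n)) (f : Fin n → Poly n)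
    (p : Poly n) : Formula n :=
  disj ((List.range (ord f p)).map fun i =>
    .and (remsZero m f p (i + 1)) (Formula.ne (lieRem m f p (i + 1))))

/-- Sentences `∃ x₁, …, ∃ xₙ, φ` with `φ` quantifier-free. -/
structure ExSentence (n : ℕ) : Type where
  body : Formula n

/-- Truth of an existential sentence over the reals. -/
def ExSentence.Holds {n : ℕ} (φ : ExSentence n) : Prop := ∃ x : Fin n → ℝ, x ∈ φ.body.toSet

open Classical in
/-- The procedure `Reduce`, which decides existential sentences of real arithmetic: its output is
the truth value of the sentence. -/
noncomputable def reduce {n : ℕ} (φ : ExSentence n) : Bool := decide φ.Holds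

/-- The recursive procedure `NonEmpty_f(S, R)`. -/
noncomputable def nonEmpty {n : ℕ} (m : MonomialOrder.{0, u} (Fin n)) (f : Fin n → Poly n) :
    Formula n → Formula n → Bool
  | .tru, R => reduce ⟨.and .fls R⟩
  | .fls, R => reduce ⟨.and .fls R⟩
  | .lt _, R => reduce ⟨.and .fls R⟩
  | .eq p, R => reduce ⟨.and (exitEq m f p) R⟩
  | .and S₁ S₂, R => nonEmpty m f S₁ (.and S₂ R) || nonEmpty m f S₂ (.and S₁ R)
  | .or S₁ S₂, R =>
    nonEmpty m f S₁ (.and (.not (inProc m f S₂)) R) ||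
      nonEmpty m f S₂ (.and (.not (inProc m f S₁)) R)
  | .not S, R => nonEmpty m f S.neg R
termination_by S => S.weight
decreasing_by
  all_goals first
    | exact weight_neg_lt _
    | (simp only [weight]; omega)

end Procedures

end ExitSet

/-! Everything follows from `exitSet_toSet`: Exit(S) = S \ In(S). Modulo the earlier remainders,
rem_i equals the i-th Lie derivative of p, so at any point the first nonvanishing remainder is the
first nonvanishing derivative of p along the trajectory, and its sign is the sign of p for small
positive times. If all Lie derivatives up to the order N vanish, then p^(N+1) ∈ ⟨p, …, p^(N)⟩ makes
(p, …, p^(N)) solve a linear ODE with zero initial value, so p stays zero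
(`eval_eq_zero_of_lie_mem_span`).

Each atom is therefore eventually true or eventually false just after time 0. This dichotomy
survives ∧, ∨ and ¬, and In(S) records which case holds (`eventually_mem_or_notMem`). The recursion
of `nonEmpty` then reduces to set identities for S \ In(S), the emptiness of exit sets of open sets,
and the fact that Neg describes the complement. -/

namespace ExitSet

open MvPolynomial Filter Topology Set

/-! ### Lie derivatives modulo the remainders -/

section Algebra

variable {n : ℕ}

theorem lie_eq_mkDerivation (f : Fin n → Poly n) (p : Poly n) :
    lie f p = mkDerivation ℝ f p := by
  have hs (q : Poly n) : (∑ i, f i • pderiv i : Derivation ℝ (Poly n) (Poly n)) q = lie f q := by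
    rw [← Derivation.coeFnAddMonoidHom_apply, map_sum, Finset.sum_apply, lie]
    exact Finset.sum_congr rfl fun i _ => mul_comm _ _
  rw [← hs]
  congr 1
  classical
  refine derivation_ext fun j => ?_
  rw [mkDerivation_X, hs, lie, Finset.sum_eq_single j]
  · simp
  · intro i _ hij
    simp [pderiv_X_of_ne (Ne.symm hij)]
  · simp

theorem lie_add (f : Fin n → Poly n) (p q : Poly n) : lie f (p + q) = lie f p + lie f q := by
  simp only [lie_eq_mkDerivation, map_add]

theorem lie_neg (f : Fin n → Poly n) (p : Poly n) : lie f (-p) = -lie f p := by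
  simp only [lie_eq_mkDerivation, map_neg]

theorem lie_sub (f : Fin n → Poly n) (p q : Poly n) : lie f (p - q) = lie f p - lie f q := by
  simp only [lie_eq_mkDerivation, map_sub]

theorem lie_mul (f : Fin n → Poly n) (p q : Poly n) :
    lie f (p * q) = p * lie f q + q * lie f p := by
  simp only [lie_eq_mkDerivation, Derivation.leibniz, smul_eq_mul]

theorem iterate_lie_neg (f : Fin n → Poly n) (p : Poly n) (i : ℕ) :
    (lie f)^[i] (-p) = -(lie f)^[i] p := by
  induction i with
  | zero => rfl
  | succ i ih => rw [Function.iterate_succ_apply', ih, lie_neg, Function.iterate_succ_apply']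

/-- A cancellation step subtracts a multiple of a divisor, and moving a leading term leaves the
difference unchanged. This congruence is the only property of division that is needed. -/
theorem sub_remainder_mem (m : MonomialOrder.{0, u} (Fin n)) (F : List (Poly n)) (p : Poly n) :
    p - remainder m F p ∈ Ideal.span {g | g ∈ F} := by
  induction p using remainder.induct m F with
  | case1 => simp [remainder]
  | case2 p hp g hF ih =>
    have hrem : remainder m F p = remainder m F (cancelLT m p g) := by
      rw [remainder, dif_neg hp]
      split
      · rename_i g' hg'
        rw [hF] at hg'
        cases hg'
        rfl
      · rename_i hg'
        rw [hF] at hg'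
        cases hg'
    rw [hrem]
    have hg : g ∈ Ideal.span {g | g ∈ F} := Ideal.subset_span (List.mem_of_find?_eq_some hF)
    have := Ideal.add_mem _ ih (Ideal.mul_mem_left _
      (monomial (m.degree p - m.degree g) (m.leadingCoeff p / m.leadingCoeff g)) hg)
    rwa [cancelLT, sub_right_comm, sub_add_cancel] at this
  | case3 p hp hF ih =>
    have hrem : remainder m F p = m.leadingTerm p + remainder m F (p - m.leadingTerm p) := by
      rw [remainder, dif_neg hp]
      split
      · rename_i g' hg'
        rw [hF] at hg'
        cases hg'
      · rfl
    rwa [hrem, ← sub_sub]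

/-- The ideal generated by the first `i` remainders. -/
noncomputable def remIdeal (m : MonomialOrder.{0, u} (Fin n)) (f : Fin n → Poly n) (p : Poly n)
    (i : ℕ) : Ideal (Poly n) :=
  Ideal.span (lieRem m f p '' Iio i)

variable (m : MonomialOrder.{0, u} (Fin n)) (f : Fin n → Poly n) (p : Poly n)

theorem remIdeal_mono : Monotone (remIdeal m f p) := fun _ _ h =>
  Ideal.span_mono (image_mono (Iio_subset_Iio h))

theorem lie_lieRem_sub_mem (i : ℕ) :
    lie f (lieRem m f p i) - lieRem m f p (i + 1) ∈ remIdeal m f p (i + 1) := by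
  have h := sub_remainder_mem m (List.ofFn fun j : Fin (i + 1) => lieRem m f p j.1)
    (lie f (lieRem m f p i))
  have hs : {g | g ∈ List.ofFn fun j : Fin (i + 1) => lieRem m f p j.1} =
      lieRem m f p '' Iio (i + 1) := by
    ext g
    simp only [mem_ofPred_eq, List.mem_ofFn, mem_image, mem_Iio]
    exact ⟨fun ⟨j, hj⟩ => ⟨j, j.2, hj⟩, fun ⟨j, hj, hg⟩ => ⟨⟨j, hj⟩, hg⟩⟩
  rw [hs] at h
  rw [lieRem]
  exact h

/-- By the Leibniz rule it suffices to treat generators, and rem_j' ≡ rem_{j+1} modulo rem_0, …,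
rem_j. -/
theorem lie_mem_remIdeal_succ {i : ℕ} {q : Poly n} (hq : q ∈ remIdeal m f p i) :
    lie f q ∈ remIdeal m f p (i + 1) := by
  induction hq using Submodule.span_induction with
  | mem q hq =>
    obtain ⟨j, hj, rfl⟩ := hq
    have hj : j < i := hj
    have h₁ := remIdeal_mono m f p (by omega : j + 1 ≤ i + 1) (lie_lieRem_sub_mem m f p j)
    have h₂ : lieRem m f p (j + 1) ∈ remIdeal m f p (i + 1) :=
      Ideal.subset_span ⟨j + 1, Nat.succ_lt_succ hj, rfl⟩
    simpa using Ideal.add_mem _ h₁ h₂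
  | zero => simp [lie_eq_mkDerivation]
  | add q r _ _ hq hr => rw [lie_add]; exact Ideal.add_mem _ hq hr
  | smul a q hq' hq =>
    rw [smul_eq_mul, lie_mul]
    exact Ideal.add_mem _ (Ideal.mul_mem_left _ _ hq)
      (Ideal.mul_mem_right _ _ (remIdeal_mono m f p (Nat.le_succ i) hq'))

theorem iterate_lie_sub_lieRem_mem (i : ℕ) :
    (lie f)^[i] p - lieRem m f p i ∈ remIdeal m f p i := by
  induction i with
  | zero => simp [lieRem]
  | succ i ih =>
    -- p^(i+1) - rem_{i+1} = (p^(i) - rem_i)' + (rem_i' - rem_{i+1}).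
    have h := Ideal.add_mem _ (lie_mem_remIdeal_succ m f p ih) (lie_lieRem_sub_mem m f p i)
    rwa [lie_sub, sub_add_sub_cancel, ← Function.iterate_succ_apply' (lie f)] at h

theorem eval_iterate_lie_eq {x : Fin n → ℝ} {i : ℕ} (h : ∀ j < i, eval x (lieRem m f p j) = 0) :
    eval x ((lie f)^[i] p) = eval x (lieRem m f p i) := by
  have hle : remIdeal m f p i ≤ RingHom.ker (eval x) := by
    refine Ideal.span_le.2 ?_
    rintro _ ⟨j, hj, rfl⟩
    exact h j hj
  have := hle (iterate_lie_sub_lieRem_mem m f p i)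
  rwa [RingHom.mem_ker, map_sub, sub_eq_zero] at this

theorem lieIdeal_mono : Monotone (lieIdeal f p) := fun _ _ h =>
  Ideal.span_mono (image_mono (Iic_subset_Iic.2 h))

/-- The ring is Noetherian, so the set whose infimum defines `ord` is nonempty and the infimum is
attained. -/
theorem lieIdeal_ord {K : ℕ} (hK : ord f p ≤ K) : lieIdeal f p (ord f p) = lieIdeal f p K := by
  obtain ⟨k, hk⟩ := monotone_stabilizes_iff_noetherian.2
    (inferInstance : IsNoetherian (Poly n) (Poly n)) ⟨lieIdeal f p, lieIdeal_mono f p⟩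
  have hne : {k | ∀ K, k ≤ K → lieIdeal f p k = lieIdeal f p K}.Nonempty := ⟨k, hk⟩
  exact Nat.sInf_mem hne K hK

end Algebra

/-! ### Trajectories and the local flow -/

section Trajectories

variable {n : ℕ} {f : Fin n → Poly n}

theorem contDiff_vectorField (f : Fin n → Poly n) : ContDiff ℝ 1 (vectorField f) :=
  contDiff_pi.2 fun i => (AnalyticOnNhd.eval_mvPolynomial (f i)).contDiff

theorem IsSolution.hasDerivAt {x : Fin n → ℝ} {a b : ℝ} {γ : ℝ → Fin n → ℝ}
    (h : IsSolution f x a b γ) {t : ℝ} (ht : t ∈ Ioo a b) :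
    HasDerivAt γ (vectorField f (γ t)) t :=
  (h.2.2.2 t ht).hasDerivAt (Ioo_mem_nhds ht.1 ht.2)

theorem exists_isSolution (f : Fin n → Poly n) (x : Fin n → ℝ) :
    ∃ ε > 0, ∃ γ, IsSolution f x (-ε) ε γ := by
  obtain ⟨γ, h0, ε, hε, h⟩ :=
    (contDiff_vectorField f).contDiffAt
      |>.exists_forall_mem_closedBall_exists_eq_forall_mem_Ioo_hasDerivAt₀ (x₀ := x) 0
  rw [zero_sub, zero_add] at h
  exact ⟨ε, hε, γ, neg_lt_zero.2 hε, hε, h0, fun t ht => (h t ht).hasDerivWithinAt⟩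

theorem IsSolution.eq_of_nonneg {x : Fin n → ℝ} {a b c d : ℝ} {γ δ : ℝ → Fin n → ℝ}
    (hγ : IsSolution f x a b γ) (hδ : IsSolution f x c d δ) {t : ℝ} (h0 : 0 ≤ t) (hb : t < b)
    (hd : t < d) : γ t = δ t := by
  have hγ' : ∀ s ∈ Icc 0 t, HasDerivAt γ (vectorField f (γ s)) s := fun s hs =>
    hγ.hasDerivAt ⟨hγ.1.trans_le hs.1, hs.2.trans_lt hb⟩
  have hδ' : ∀ s ∈ Icc 0 t, HasDerivAt δ (vectorField f (δ s)) s := fun s hs =>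
    hδ.hasDerivAt ⟨hδ.1.trans_le hs.1, hs.2.trans_lt hd⟩
  have cγ : ContinuousOn γ (Icc 0 t) := fun s hs => (hγ' s hs).continuousAt.continuousWithinAt
  have cδ : ContinuousOn δ (Icc 0 t) := fun s hs => (hδ' s hs).continuousAt.continuousWithinAt
  -- The field is only locally Lipschitz; a uniform constant exists on the compact union of the two
  -- arcs.
  obtain ⟨K, hK⟩ := ((contDiff_vectorField f).locallyLipschitz.locallyLipschitzOn
    (s := γ '' Icc 0 t ∪ δ '' Icc 0 t)).exists_lipschitzOnWith_of_compact
      ((isCompact_Icc.image_of_continuousOn cγ).union (isCompact_Icc.image_of_continuousOn cδ))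
  exact ODE_solution_unique_of_mem_Icc_right (v := fun _ => vectorField f)
    (s := fun _ => γ '' Icc 0 t ∪ δ '' Icc 0 t) (fun _ _ => hK)
    cγ (fun s hs => (hγ' s (Ico_subset_Icc_self hs)).hasDerivWithinAt)
    (fun s hs => Or.inl ⟨s, Ico_subset_Icc_self hs, rfl⟩)
    cδ (fun s hs => (hδ' s (Ico_subset_Icc_self hs)).hasDerivWithinAt)
    (fun s hs => Or.inr ⟨s, Ico_subset_Icc_self hs, rfl⟩)
    (hγ.2.2.1.trans hδ.2.2.1.symm) ⟨h0, le_rfl⟩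

/-- `flow` chooses a solution separately for each time; uniqueness makes these choices agree with
any single solution. -/
theorem IsSolution.flow_eq {x : Fin n → ℝ} {a b : ℝ} {γ : ℝ → Fin n → ℝ}
    (hγ : IsSolution f x a b γ) {t : ℝ} (h0 : 0 ≤ t) (hb : t < b) : flow f t x = γ t := by
  have h : t ∈ maxInterval f x := ⟨a, b, γ, hγ, hγ.1.trans_le h0, hb⟩
  rw [flow, dif_pos h]
  have hs := h.choose_spec.choose_spec.choose_spec
  exact hs.1.eq_of_nonneg hγ h0 hs.2.2 hb

/-- Exit depends only on the germ of one trajectory at 0 from the right, so any local solution can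
test it. -/
theorem IsSolution.mem_exitSet_iff {x : Fin n → ℝ} {a b : ℝ} {γ : ℝ → Fin n → ℝ}
    (hγ : IsSolution f x a b γ) (S : Set (Fin n → ℝ)) :
    x ∈ exitSet f S ↔ x ∈ S ∧ ¬ ∀ᶠ t in 𝓝[>] (0 : ℝ), γ t ∈ S := by
  refine and_congr_right fun _ => ⟨fun h hev => ?_, fun h t ⟨c, d, δ, hδ, ht⟩ h0 => ?_⟩
  · obtain ⟨c, hc, hS⟩ := mem_nhdsGT_iff_exists_Ioo_subset.1 hev
    have hc : 0 < c := hc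
    have hb : 0 < b := hγ.2.1
    obtain ⟨t, ht0, ht⟩ := exists_between (lt_min hc hb)
    obtain ⟨s, hs, hsS⟩ := h t ⟨a, b, γ, hγ, hγ.1.trans ht0, ht.trans_le (min_le_right _ _)⟩ ht0
    have hst := hs.2.trans ht
    rw [hγ.flow_eq hs.1.le (hst.trans_le (min_le_right _ _))] at hsS
    exact hsS (hS ⟨hs.1, hst.trans_le (min_le_left _ _)⟩)
  · by_contra! hS
    refine h (mem_of_superset (Ioo_mem_nhdsGT (lt_min h0 hγ.2.1)) fun s hs => ?_)
    have := hS s ⟨hs.1, hs.2.trans_le (min_le_left _ _)⟩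
    rwa [hγ.flow_eq hs.1.le (hs.2.trans_le (min_le_right _ _))] at this

end Trajectories

/-! ### Signs of polynomials along trajectories -/

section Signs

variable {n : ℕ} {f : Fin n → Poly n}

theorem hasDerivAt_eval {γ : ℝ → Fin n → ℝ} {t : ℝ}
    (h : HasDerivAt γ (vectorField f (γ t)) t) (p : Poly n) :
    HasDerivAt (fun s => eval (γ s) p) (eval (γ t) (lie f p)) t := by
  induction p using MvPolynomial.induction_on with
  | C a => simpa [lie_eq_mkDerivation] using hasDerivAt_const t a
  | add p q hp hq =>
    simp only [lie_add, map_add]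
    exact hp.add hq
  | mul_X p i hp =>
    have hX := hasDerivAt_pi.1 h i
    have : HasDerivAt (fun s => eval (γ s) p * γ s i) _ t := hp.mul hX
    have hl : lie f (X i) = f i := by rw [lie_eq_mkDerivation, mkDerivation_X]
    simp only [lie_mul, hl, map_mul, map_add, eval_X]
    convert this using 1
    rw [vectorField]
    ring

/-- Along γ the vector of values of `q` satisfies a linear ODE with continuous coefficients and zero
initial value, so Grönwall's inequality forces it to vanish. -/
theorem IsSolution.eval_eq_zero_of_lie_mem_span {x : Fin n → ℝ} {a b : ℝ} {γ : ℝ → Fin n → ℝ}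
    (hγ : IsSolution f x a b γ) {k : ℕ} (q : Fin k → Poly n)
    (hq : ∀ i, lie f (q i) ∈ Ideal.span (range q)) (hx : ∀ i, eval x (q i) = 0)
    {t : ℝ} (h0 : 0 ≤ t) (hb : t < b) (i : Fin k) : eval (γ t) (q i) = 0 := by
  choose c hc using fun i => Ideal.mem_span_range_iff_exists_fun.1 (hq i)
  have hd : ∀ s ∈ Icc 0 t, HasDerivAt γ (vectorField f (γ s)) s := fun s hs =>
    hγ.hasDerivAt ⟨hγ.1.trans_le hs.1, hs.2.trans_lt hb⟩
  have cγ : ContinuousOn γ (Icc 0 t) := fun s hs => (hd s hs).continuousAt.continuousWithinAt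
  have hbound : ∀ i j, ∃ C, ∀ s ∈ Icc 0 t, ‖eval (γ s) (c i j)‖ ≤ C := fun i j =>
    isCompact_Icc.exists_bound_of_continuousOn ((continuous_eval (c i j)).comp_continuousOn cγ)
  choose C hC using hbound
  have hC0 : ∀ i j, 0 ≤ C i j := fun i j => (norm_nonneg _).trans (hC i j 0 ⟨le_rfl, h0⟩)
  have hy : ∀ s ∈ Icc 0 t, HasDerivAt (fun s i => eval (γ s) (q i))
      (fun i => eval (γ s) (lie f (q i))) s := fun s hs =>
    hasDerivAt_pi.2 fun i => hasDerivAt_eval (hd s hs) (q i)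
  -- The sum of all entrywise bounds is a crude bound for the coefficient matrix in the sup norm.
  have key := eq_zero_of_abs_deriv_le_mul_abs_self_of_eq_zero_right (K := ∑ i, ∑ j, C i j)
    (f := fun s i => eval (γ s) (q i)) (f' := fun s i => eval (γ s) (lie f (q i)))
    (fun s hs => (hy s hs).continuousAt.continuousWithinAt)
    (fun s hs => (hy s (Ico_subset_Icc_self hs)).hasDerivWithinAt)
    (funext fun i => by rw [hγ.2.2.1]; exact hx i) (fun s hs => ?_) t ⟨h0, le_rfl⟩
  · exact congrFun key i
  have hs := Ico_subset_Icc_self hs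
  set y : Fin k → ℝ := fun i => eval (γ s) (q i) with hydef
  have hK : 0 ≤ ∑ i, ∑ j, C i j := Finset.sum_nonneg fun i _ => Finset.sum_nonneg fun j _ => hC0 i j
  refine (pi_norm_le_iff_of_nonneg (mul_nonneg hK (norm_nonneg y))).2 fun i => ?_
  rw [← hc i, map_sum]
  calc ‖∑ j, eval (γ s) (c i j * q j)‖ ≤ ∑ j, ‖eval (γ s) (c i j * q j)‖ := norm_sum_le _ _
    _ ≤ ∑ j, C i j * ‖y‖ := Finset.sum_le_sum fun j _ => by
        rw [map_mul, norm_mul]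
        exact mul_le_mul (hC i j s hs) (norm_le_pi_norm y j) (norm_nonneg _) (hC0 i j)
    _ = (∑ j, C i j) * ‖y‖ := by rw [Finset.sum_mul]
    _ ≤ (∑ i, ∑ j, C i j) * ‖y‖ := mul_le_mul_of_nonneg_right
        (Finset.single_le_sum (f := fun i => ∑ j, C i j)
          (fun i _ => Finset.sum_nonneg fun j _ => hC0 i j) (Finset.mem_univ i)) (norm_nonneg y)

theorem IsSolution.eventually_eval_eq_zero {x : Fin n → ℝ} {a b : ℝ} {γ : ℝ → Fin n → ℝ}
    (hγ : IsSolution f x a b γ) {p : Poly n}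
    (hx : ∀ i ≤ ord f p, eval x ((lie f)^[i] p) = 0) :
    ∀ᶠ t in 𝓝[>] (0 : ℝ), eval (γ t) p = 0 := by
  have hspan : Ideal.span (range fun i : Fin (ord f p + 1) => (lie f)^[i.1] p) =
      lieIdeal f p (ord f p) := by
    rw [lieIdeal]
    congr 1
    ext g
    simp only [mem_range, mem_image, mem_Iic]
    exact ⟨fun ⟨i, hi⟩ => ⟨i, Nat.lt_succ_iff.1 i.2, hi⟩,
      fun ⟨i, hi, hg⟩ => ⟨⟨i, Nat.lt_succ_iff.2 hi⟩, hg⟩⟩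
  refine mem_of_superset (Ioo_mem_nhdsGT hγ.2.1) fun t ht => ?_
  refine hγ.eval_eq_zero_of_lie_mem_span (fun i : Fin (ord f p + 1) => (lie f)^[i.1] p)
    (fun i => ?_) (fun i => hx i (Nat.lt_succ_iff.1 i.2)) ht.1.le ht.2 0
  -- Enlarging the ideal from `ord f p` to `ord f p + 1` changes nothing but makes room for the
  -- derivative of the last generator.
  rw [hspan, lieIdeal_ord f p (Nat.le_succ _), ← Function.iterate_succ_apply' (lie f)]
  exact Ideal.subset_span ⟨i + 1, i.2, rfl⟩

theorem IsSolution.continuousAt_zero {x : Fin n → ℝ} {a b : ℝ} {γ : ℝ → Fin n → ℝ}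
    (hγ : IsSolution f x a b γ) : ContinuousAt γ 0 :=
  (hγ.hasDerivAt ⟨hγ.1, hγ.2.1⟩).continuousAt

/-- Induction on `i`, applied to p': once p' is positive just after 0, p increases strictly from the
value 0. -/
theorem IsSolution.eventually_eval_pos {x : Fin n → ℝ} {a b : ℝ} {γ : ℝ → Fin n → ℝ}
    (hγ : IsSolution f x a b γ) {p : Poly n} {i : ℕ}
    (h0 : ∀ j < i, eval x ((lie f)^[j] p) = 0) (hi : 0 < eval x ((lie f)^[i] p)) :
    ∀ᶠ t in 𝓝[>] (0 : ℝ), 0 < eval (γ t) p := by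
  induction i generalizing p with
  | zero =>
    have hc : ContinuousAt (fun t => eval (γ t) p) 0 :=
      (continuous_eval p).continuousAt.comp hγ.continuousAt_zero
    refine (hc.eventually_const_lt ?_).filter_mono nhdsWithin_le_nhds
    change 0 < eval (γ 0) p
    rw [hγ.2.2.1]
    exact hi
  | succ i ih =>
    have hd := ih (p := lie f p) (fun j hj => h0 (j + 1) (Nat.succ_lt_succ hj)) hi
    obtain ⟨c, hc, hS⟩ := mem_nhdsGT_iff_exists_Ioo_subset.1 hd
    refine mem_of_superset (Ioo_mem_nhdsGT (lt_min hc hγ.2.1)) fun t ht => ?_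
    have hder : ∀ s ∈ Icc 0 t, HasDerivAt (fun s => eval (γ s) p) (eval (γ s) (lie f p)) s :=
      fun s hs => hasDerivAt_eval (hγ.hasDerivAt
        ⟨hγ.1.trans_le hs.1, hs.2.trans_lt (ht.2.trans_le (min_le_right _ _))⟩) p
    have hmono : StrictMonoOn (fun s => eval (γ s) p) (Icc 0 t) := by
      refine strictMonoOn_of_deriv_pos (convex_Icc 0 t)
        (fun s hs => (hder s hs).continuousAt.continuousWithinAt) fun s hs => ?_
      rw [(hder s (interior_subset hs)).deriv]
      rw [interior_Icc] at hs
      exact hS ⟨hs.1, hs.2.trans (ht.2.trans_le (min_le_left _ _))⟩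
    have := hmono ⟨le_rfl, ht.1.le⟩ ⟨ht.1.le, le_rfl⟩ ht.1
    have hx : eval (γ 0) p = 0 := by rw [hγ.2.2.1]; exact h0 0 (Nat.succ_pos i)
    exact hx.symm.trans_lt this

theorem IsSolution.eventually_eval_neg {x : Fin n → ℝ} {a b : ℝ} {γ : ℝ → Fin n → ℝ}
    (hγ : IsSolution f x a b γ) {p : Poly n} {i : ℕ}
    (h0 : ∀ j < i, eval x ((lie f)^[j] p) = 0) (hi : eval x ((lie f)^[i] p) < 0) :
    ∀ᶠ t in 𝓝[>] (0 : ℝ), eval (γ t) p < 0 := by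
  have := hγ.eventually_eval_pos (p := -p) (i := i)
    (fun j hj => by rw [iterate_lie_neg, map_neg, h0 j hj, neg_zero])
    (by rw [iterate_lie_neg, map_neg]; exact neg_pos.2 hi)
  simpa only [map_neg, neg_pos] using this

end Signs

/-! ### Semantics of the formulas and of In -/

section Formulas

open Formula

variable {n : ℕ}

theorem Formula.mem_conj {l : List (Formula n)} {x : Fin n → ℝ} :
    x ∈ (conj l).toSet ↔ ∀ S ∈ l, x ∈ S.toSet := by
  induction l with
  | nil => simp [conj, toSet]
  | cons S l ih => rw [List.forall_mem_cons, ← ih]; rfl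

theorem Formula.mem_disj {l : List (Formula n)} {x : Fin n → ℝ} :
    x ∈ (disj l).toSet ↔ ∃ S ∈ l, x ∈ S.toSet := by
  induction l with
  | nil => simp [disj, toSet]
  | cons S l ih => rw [List.exists_mem_cons_iff, ← ih]; rfl

theorem Formula.toSet_neg (S : Formula n) : S.neg.toSet = S.toSetᶜ := by
  ext x
  cases S with
  | lt p => simp [neg, toSet, le_iff_lt_or_eq, eq_comm]
  | eq p => simpa [neg, toSet] using lt_or_lt_iff_ne.trans ne_comm
  | _ => simp [neg, toSet, imp_iff_not_or]

theorem Formula.mem_ne {p : Poly n} {x : Fin n → ℝ} :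
    x ∈ (Formula.ne p).toSet ↔ eval x p ≠ 0 := by
  simpa [Formula.ne, toSet] using lt_or_lt_iff_ne.trans ne_comm

variable (m : MonomialOrder.{0, u} (Fin n)) (f : Fin n → Poly n)

theorem mem_remsZero {p : Poly n} {k : ℕ} {x : Fin n → ℝ} :
    x ∈ (remsZero m f p k).toSet ↔ ∀ j < k, eval x (lieRem m f p j) = 0 := by
  simp [remsZero, mem_conj, toSet]

theorem mem_inProc_eq {p : Poly n} {x : Fin n → ℝ} :
    x ∈ (inProc m f (.eq p)).toSet ↔ ∀ j ≤ ord f p, eval x (lieRem m f p j) = 0 := by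
  simp [inProc, mem_remsZero]

theorem mem_inProc_lt {p : Poly n} {x : Fin n → ℝ} :
    x ∈ (inProc m f (.lt p)).toSet ↔
      ∃ i ≤ ord f p, (∀ j < i, eval x (lieRem m f p j) = 0) ∧ eval x (lieRem m f p i) < 0 := by
  simp [inProc, mem_disj, Formula.toSet, mem_remsZero]

theorem mem_exitEq {p : Poly n} {x : Fin n → ℝ} :
    x ∈ (exitEq m f p).toSet ↔ ∃ i < ord f p, (∀ j < i + 1, eval x (lieRem m f p j) = 0) ∧
      eval x (lieRem m f p (i + 1)) ≠ 0 := by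
  simp [exitEq, mem_disj, Formula.toSet, mem_remsZero, mem_ne]

variable {f}

/-- Near a point, a polynomial has a constant sign along the trajectory, determined by the first
nonvanishing remainder. -/
theorem IsSolution.sign_trichotomy {x : Fin n → ℝ} {a b : ℝ} {γ : ℝ → Fin n → ℝ}
    (hγ : IsSolution f x a b γ) (p : Poly n) :
    ((∀ j ≤ ord f p, eval x (lieRem m f p j) = 0) ∧ ∀ᶠ t in 𝓝[>] (0 : ℝ), eval (γ t) p = 0) ∨
    ∃ i ≤ ord f p, (∀ j < i, eval x (lieRem m f p j) = 0) ∧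
      (eval x (lieRem m f p i) < 0 ∧ (∀ᶠ t in 𝓝[>] (0 : ℝ), eval (γ t) p < 0) ∨
        0 < eval x (lieRem m f p i) ∧ ∀ᶠ t in 𝓝[>] (0 : ℝ), 0 < eval (γ t) p) := by
  classical
  by_cases h : ∀ j ≤ ord f p, eval x (lieRem m f p j) = 0
  · refine Or.inl ⟨h, hγ.eventually_eval_eq_zero fun i hi => ?_⟩
    rw [eval_iterate_lie_eq m f p fun j hj => h j (hj.le.trans hi), h i hi]
  · push Not at h
    obtain ⟨hi, hne⟩ := Nat.find_spec h
    have hlt : ∀ j < Nat.find h, eval x (lieRem m f p j) = 0 := fun j hj => by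
      by_contra hj'
      exact Nat.find_min h hj ⟨hj.le.trans hi, hj'⟩
    -- Up to the first nonvanishing remainder, remainders and Lie derivatives take the same values
    -- at `x`.
    have heq : ∀ j ≤ Nat.find h, eval x ((lie f)^[j] p) = eval x (lieRem m f p j) := fun j hj =>
      eval_iterate_lie_eq m f p fun k hk => hlt k (hk.trans_le hj)
    have h0 : ∀ j < Nat.find h, eval x ((lie f)^[j] p) = 0 := fun j hj =>
      (heq j hj.le).trans (hlt j hj)
    refine Or.inr ⟨Nat.find h, hi, hlt, ?_⟩
    rcases hne.lt_or_gt with hs | hs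
    · exact Or.inl ⟨hs, hγ.eventually_eval_neg h0 (by rwa [heq _ le_rfl])⟩
    · exact Or.inr ⟨hs, hγ.eventually_eval_pos h0 (by rwa [heq _ le_rfl])⟩

/-- "Eventually" does not commute with ¬ or ∨ in general. Carrying both alternatives through the
induction is what lets In commute with the connectives. -/
theorem IsSolution.eventually_mem_or_notMem {x : Fin n → ℝ} {a b : ℝ} {γ : ℝ → Fin n → ℝ}
    (hγ : IsSolution f x a b γ) (S : Formula n) :
    (x ∈ (inProc m f S).toSet ∧ ∀ᶠ t in 𝓝[>] (0 : ℝ), γ t ∈ S.toSet) ∨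
      (x ∉ (inProc m f S).toSet ∧ ∀ᶠ t in 𝓝[>] (0 : ℝ), γ t ∉ S.toSet) := by
  induction S with
  | tru => simp [inProc, Formula.toSet]
  | fls => simp [inProc, Formula.toSet]
  | lt p =>
    rw [mem_inProc_lt]
    rcases hγ.sign_trichotomy m p with ⟨h, hp⟩ | ⟨i, hi, h0, ⟨h, hp⟩ | ⟨h, hp⟩⟩
    · exact Or.inr ⟨fun ⟨i, hi, _, hlt⟩ => hlt.ne (h i hi), hp.mono fun t ht => ht.not_lt⟩
    · exact Or.inl ⟨⟨i, hi, h0, h⟩, hp⟩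
    · refine Or.inr ⟨fun ⟨k, _, hk, hlt⟩ => ?_, hp.mono fun t ht => ht.not_gt⟩
      -- Both `i` and `k` index the first nonvanishing remainder, so they coincide, and the signs
      -- there clash.
      rcases lt_trichotomy i k with hik | rfl | hik
      · exact h.ne' (hk i hik)
      · exact h.not_gt hlt
      · exact hlt.ne (h0 k hik)
  | eq p =>
    rw [mem_inProc_eq]
    rcases hγ.sign_trichotomy m p with ⟨h, hp⟩ | ⟨i, hi, h0, ⟨h, hp⟩ | ⟨h, hp⟩⟩
    · exact Or.inl ⟨h, hp⟩
    · exact Or.inr ⟨fun hz => h.ne (hz i hi), hp.mono fun t ht => ht.ne⟩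
    · exact Or.inr ⟨fun hz => h.ne' (hz i hi), hp.mono fun t ht => ht.ne'⟩
  | and S₁ S₂ h₁ h₂ =>
    rcases h₁ with ⟨h₁, e₁⟩ | ⟨h₁, e₁⟩
    · rcases h₂ with ⟨h₂, e₂⟩ | ⟨h₂, e₂⟩
      · exact Or.inl ⟨⟨h₁, h₂⟩, e₁.and e₂⟩
      · exact Or.inr ⟨fun h => h₂ h.2, e₂.mono fun t ht h => ht h.2⟩
    · exact Or.inr ⟨fun h => h₁ h.1, e₁.mono fun t ht h => ht h.1⟩
  | or S₁ S₂ h₁ h₂ =>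
    rcases h₁ with ⟨h₁, e₁⟩ | ⟨h₁, e₁⟩
    · exact Or.inl ⟨Or.inl h₁, e₁.mono fun t ht => Or.inl ht⟩
    · rcases h₂ with ⟨h₂, e₂⟩ | ⟨h₂, e₂⟩
      · exact Or.inl ⟨Or.inr h₂, e₂.mono fun t ht => Or.inr ht⟩
      · exact Or.inr ⟨fun h => h.elim h₁ h₂, (e₁.and e₂).mono fun t ht h => h.elim ht.1 ht.2⟩
  | not S h =>
    rcases h with ⟨h, e⟩ | ⟨h, e⟩
    · exact Or.inr ⟨fun h' => h' h, e.mono fun t ht h' => h' ht⟩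
    · exact Or.inl ⟨h, e⟩

/-! ### Exit sets and correctness of `nonEmpty` -/

variable (f)

theorem exitSet_toSet (S : Formula n) : exitSet f S.toSet = S.toSet \ (inProc m f S).toSet := by
  ext x
  obtain ⟨ε, _, γ, hγ⟩ := exists_isSolution f x
  rw [hγ.mem_exitSet_iff, Set.mem_sdiff]
  refine and_congr_right fun _ => not_congr ?_
  rcases hγ.eventually_mem_or_notMem m S with ⟨h, e⟩ | ⟨h, e⟩
  · exact iff_of_true e h
  · refine iff_of_false (fun e' => ?_) h
    -- The filter of right neighbourhoods of 0 is nontrivial, so contradictory eventual properties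
    -- cannot both hold.
    obtain ⟨t, ht, ht'⟩ := (e.and e').exists
    exact ht ht'

/-- By continuity a trajectory starting in an open set stays there for a short time. This covers the
atoms T, F and p < 0. -/
theorem exitSet_eq_empty_of_isOpen {U : Set (Fin n → ℝ)} (hU : IsOpen U) : exitSet f U = ∅ := by
  refine eq_empty_of_forall_notMem fun x hx => ?_
  obtain ⟨ε, _, γ, hγ⟩ := exists_isSolution f x
  rw [hγ.mem_exitSet_iff] at hx
  refine hx.2 ((hγ.continuousAt_zero.eventually_mem (hU.mem_nhds ?_)).filter_mono
    nhdsWithin_le_nhds)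
  rw [hγ.2.2.1]
  exact hx.1

theorem exitSet_eq (p : Poly n) : exitSet f (Formula.eq p).toSet = (exitEq m f p).toSet := by
  classical
  rw [exitSet_toSet m]
  ext x
  rw [Set.mem_sdiff, mem_inProc_eq, mem_exitEq]
  constructor
  · rintro ⟨hx, h⟩
    push Not at h
    obtain ⟨hi, hne⟩ := Nat.find_spec h
    have hlt : ∀ j < Nat.find h, eval x (lieRem m f p j) = 0 := fun j hj => by
      by_contra hj'
      exact Nat.find_min h hj ⟨hj.le.trans hi, hj'⟩
    -- The first nonvanishing index is positive because rem_0 = p vanishes at `x`; this matches the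
    -- disjunction starting at 1.
    have h0 : Nat.find h ≠ 0 := fun h0 => by
      rw [h0, lieRem] at hne
      exact hne hx
    obtain ⟨k, hk⟩ := Nat.exists_eq_succ_of_ne_zero h0
    rw [hk] at hi hne hlt
    exact ⟨k, hi, hlt, hne⟩
  · rintro ⟨i, hi, h0, hne⟩
    refine ⟨?_, fun h => hne (h _ hi)⟩
    have := h0 0 (Nat.succ_pos i)
    rwa [lieRem] at this

theorem exitSet_and (m : MonomialOrder.{0, u} (Fin n)) (S₁ S₂ : Formula n) :
    exitSet f (S₁.and S₂).toSet =
    exitSet f S₁.toSet ∩ S₂.toSet ∪ exitSet f S₂.toSet ∩ S₁.toSet := by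
  ext x
  rw [exitSet_toSet m, exitSet_toSet m, exitSet_toSet m]
  simp only [inProc, Formula.toSet, Set.mem_sdiff, mem_inter_iff, mem_union]
  tauto

/-- (S₁ ∪ S₂) \ (In S₁ ∪ In S₂) splits according to which Sᵢ contains the point; the other disjunct
must still fail to hold just afterwards, whence the complement of its In. -/
theorem exitSet_or (S₁ S₂ : Formula n) : exitSet f (S₁.or S₂).toSet =
    exitSet f S₁.toSet ∩ (inProc m f S₂).toSetᶜ ∪
      exitSet f S₂.toSet ∩ (inProc m f S₁).toSetᶜ := by
  ext x
  rw [exitSet_toSet m, exitSet_toSet m, exitSet_toSet m]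
  simp only [inProc, Formula.toSet, Set.mem_sdiff, mem_inter_iff, mem_union,
    mem_compl_iff]
  tauto

theorem reduce_eq_true_iff (S : Formula n) : reduce ⟨S⟩ = true ↔ S.toSet.Nonempty := by
  classical
  exact decide_eq_true_iff

/-- The induction follows the recursion of `nonEmpty`, since `S.neg` need not be a subformula of
`S.not` and the second argument changes along the way. -/
theorem nonEmpty_eq_true_iff (S R : Formula n) :
    nonEmpty m f S R = true ↔ (exitSet f S.toSet ∩ R.toSet).Nonempty := by
  induction S, R using nonEmpty.induct m f with
  | case1 R =>
    rw [nonEmpty, reduce_eq_true_iff, exitSet_eq_empty_of_isOpen f (U := toSet tru) isOpen_univ]; rfl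
  | case2 R =>
    rw [nonEmpty, reduce_eq_true_iff, exitSet_eq_empty_of_isOpen f (U := toSet fls) isOpen_empty]; rfl
  | case3 p R =>
    rw [nonEmpty, reduce_eq_true_iff,
      exitSet_eq_empty_of_isOpen f (U := toSet (.lt p)) (isOpen_lt (continuous_eval p) continuous_const)]; rfl
  | case4 p R => rw [nonEmpty, reduce_eq_true_iff, exitSet_eq m]; rfl
  | case5 S₁ S₂ R h₁ h₂ =>
    rw [nonEmpty, Bool.or_eq_true, h₁, h₂, exitSet_and f m, union_inter_distrib_right,
      union_nonempty, inter_assoc, inter_assoc]; rfl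
  | case6 S₁ S₂ R h₁ h₂ =>
    rw [nonEmpty, Bool.or_eq_true, h₁, h₂, exitSet_or m, union_inter_distrib_right,
      union_nonempty, inter_assoc, inter_assoc]; rfl
  | case7 S R h => rw [nonEmpty, h, Formula.toSet_neg]; rfl

end Formulas

end ExitSet


theorem mainTheorem3 (n : ℕ) (m : MonomialOrder.{0, u} (Fin n))
    (f : Fin n → ExitSet.Poly n) (S R : ExitSet.Formula n) :
    ExitSet.nonEmpty m f S R = false ↔ ExitSet.exitSet f S.toSet ∩ R.toSet = ∅ := by
  rw [← Set.not_nonempty_iff_eq_empty, ← ExitSet.nonEmpty_eq_true_iff m, Bool.not_eq_true]
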